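/- Let $B,\Delta t,\Delta s>0$, $\beta,\eta_1,\eta_2\in\mathbb R$, and let $\alpha_1,\alpha_2\in\mathbb R$ satisfy $\alpha_2/\alpha_1<0$ and $g:=|\alpha_2/\alpha_1|\in\mathbb N$. Put $\xi_\ell=B|\alpha_\ell|\Delta s$ for $\ell=1,2$, $\zeta=\beta/(|\alpha_1|\Delta s)$, and define $$c_j=\frac{\sqrt\pi}{2B\Delta t}\Big[e^{-(\xi_1j)^2/4}\cos(\eta_1j)+e^{-(\xi_2j)^2/4}\cos(\eta_2j)\Big]\quad(j\in\mathbb Z),\qquad h_j=\frac{\sqrt\pi}{2B\Delta t}\,e^{-[\xi_1(j+\zeta)]^2/4}\cos[\eta_1(j+\zeta)]\quad(j\in\mathbb N,\ j\ge 0).$$ For $n\ge 0$ let $T_n,H_n\in\mathbb R^{(n+1)\times(n+1)}$ be the Toeplitz and g-Hankel matrices $(T_n)_{jl}=c_{j-l}$, $(H_n)_{jl}=h_{(j-1)+g(l-1)}$, $j,l=1,\dots,n+1$, and let $C_n=T_n+H_n+H_n^T$. Let $Q(\theta)=\sum_{j\in\mathbb Z}c_je^{ij\theta}$ and $\|Q\|_\infty=\sup_{\theta\in(-\pi,\pi)}|Q(\theta)|$.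 Denote by $\sigma_1(A)\ge\dots\ge\sigma_{n+1}(A)$ the singular values of $A\in\mathbb R^{(n+1)\times(n+1)}$. Then: 1. $\sum_{j\in\mathbb Z}|c_j|<\infty$, and $Q$ is real valued, bounded and measurable on $(-\pi,\pi)$. 2. $\{C_n\}$ is distributed in the sense of singular values as $(Q,(-\pi,\pi))$: for every continuous $F:[0,\infty)\to\mathbb R$ with bounded support, $$\lim_{n\to\infty}\frac1{n+1}\sum_{j=1}^{n+1}F(\sigma_j(C_n))=\frac1{2\pi}\int_{-\pi}^{\pi}F(|Q(\theta)|)\,d\theta .$$ 3. The singular values are bounded uniformly in $n$: $\sum_{j\ge0}|h_j|<\infty$, and there is a constant $\Sigma_T$ such that for all $n$ and $j$ one has $\sigma_j(T_n)\le\Sigma_T$ and $\sigma_j(C_n)\le\Sigma_T+2\sum_{k\ge0}|h_k|$. 4. For every $\epsilon>0$ the limit in 2 also holds for the threshold function $F=1_{[\epsilon\|Q\|_\infty,\infty)}$. Moreover, the number of singular values of $C_n$ in $[\epsilon\|Q\|_\infty,\infty)$ divided by $n+1$, and the normalized essential rank of $C_n$, that is, the number of eigenvalues of the symmetric matrix $C_n$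 in $[\epsilon\|Q\|_\infty,\infty)$ divided by $n+1$ (both counted with multiplicity), both converge, as $n\to\infty$, to $$\frac1{2\pi}\,\big|\{\theta\in(-\pi,\pi):Q(\theta)\ge\epsilon\|Q\|_\infty\}\big| .$$ -/

import Mathlib

open Real Filter Topology MeasureTheory

noncomputable section

namespace ToeplitzHankel

/-- The parameters of the two-target model: pulse bandwidth `B`, fast time step `Δt`, slow time
step `Δs`, the dimensionless slopes `α₁, α₂`, the range offset parameter `β`, and the frequencies
`η₁, η₂` of the cosine modulations. -/
structure Params where
  B : ℝ
  Δt : ℝ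
  Δs : ℝ
  α₁ : ℝ
  α₂ : ℝ
  β : ℝ
  η₁ : ℝ
  η₂ : ℝ
  B_pos : 0 < B
  Δt_pos : 0 < Δt
  Δs_pos : 0 < Δs
  ratio_neg : α₂ / α₁ < 0

namespace Params

variable (p : Params)

/-- The common amplitude `√π / (2 B Δt)`. -/
def amp : ℝ := √π / (2 * p.B * p.Δt)

/-- `ξ₁ = B |α₁| Δs`. -/
def ξ₁ : ℝ := p.B * |p.α₁| * p.Δs

/-- `ξ₂ = B |α₂| Δs`. -/
def ξ₂ : ℝ := p.B * |p.α₂| * p.Δs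

/-- `ζ = β / (|α₁| Δs)`. -/
def ζ : ℝ := p.β / (|p.α₁| * p.Δs)

/-- The sequence `c_j`, `j ∈ ℤ`, defining the Toeplitz matrices. -/
def c (j : ℤ) : ℝ :=
  p.amp * (exp (-(p.ξ₁ * j) ^ 2 / 4) * cos (p.η₁ * j)
    + exp (-(p.ξ₂ * j) ^ 2 / 4) * cos (p.η₂ * j))

/-- The sequence `h_j`, `j ∈ ℕ`, defining the g-Hankel matrices. -/
def h (j : ℕ) : ℝ :=
  p.amp * (exp (-(p.ξ₁ * (j + p.ζ)) ^ 2 / 4) * cos (p.η₁ * (j + p.ζ)))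

end Params

/-- The `(n+1) × (n+1)` Toeplitz matrix with entries `c_{j-l}`. -/
def toeplitz (c : ℤ → ℝ) (n : ℕ) : Matrix (Fin (n + 1)) (Fin (n + 1)) ℝ :=
  Matrix.of fun j l => c ((j : ℤ) - (l : ℤ))

/-- The `(n+1) × (n+1)` g-Hankel matrix with shift `g`: with indices running from `0` to `n`, its
entries are `h_{j + g l}`. -/
def gHankel (g : ℕ) (h : ℕ → ℝ) (n : ℕ) : Matrix (Fin (n + 1)) (Fin (n + 1)) ℝ :=
  Matrix.of fun j l => h ((j : ℕ) + g * (l : ℕ))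

/-- The matrix `C_n = T_n + H_n + H_nᵀ`. -/
def covMatrix (p : Params) (g n : ℕ) : Matrix (Fin (n + 1)) (Fin (n + 1)) ℝ :=
  toeplitz p.c n + gHankel g p.h n + (gHankel g p.h n).transpose

theorem Params.c_neg (p : Params) (j : ℤ) : p.c (-j) = p.c j := by
  simp [Params.c]

theorem covMatrix_isHermitian (p : Params) (g n : ℕ) : (covMatrix p g n).IsHermitian := by
  ext j l
  have e : p.c ((l : ℤ) - (j : ℤ)) = p.c ((j : ℤ) - (l : ℤ)) := by
    rw [← p.c_neg, neg_sub]
  simp only [covMatrix, toeplitz, gHankel, Matrix.conjTranspose_apply, Matrix.add_apply,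
    Matrix.of_apply, Matrix.transpose_apply, star_trivial, e]
  ring

/-- The symbol `Q(θ) = ∑_{j ∈ ℤ} c_j e^{i j θ}`. -/
def symbol (c : ℤ → ℝ) (θ : ℝ) : ℂ :=
  ∑' j : ℤ, (c j : ℂ) * Complex.exp (Complex.I * j * θ)

/-- `‖Q‖_∞ = sup_{θ ∈ (-π, π)} |Q(θ)|`. -/
def supNorm (Q : ℝ → ℂ) : ℝ := ⨆ θ : Set.Ioo (-π) π, ‖Q θ‖

/-- The singular values of a square real matrix of size `n + 1`, in descending order; `σ A j` for
`j = 0, …, n` is the `(j+1)`-st one. -/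
def σ {n : ℕ} (A : Matrix (Fin (n + 1)) (Fin (n + 1)) ℝ) (j : Fin (n + 1)) : ℝ :=
  (Matrix.toEuclideanLin A).singularValues (j : ℕ)

/-- `{A_n} ∼_σ (Q, U)` with `U = (-π, π)`: distribution in the sense of singular values. The test
functions are the continuous functions on `[0, ∞)` with bounded support. -/
def SVDistributed (A : ∀ n : ℕ, Matrix (Fin (n + 1)) (Fin (n + 1)) ℝ) (Q : ℝ → ℂ) : Prop :=
  (Measurable fun θ : Set.Ioo (-π) π => Q θ) ∧
  ∀ F : ℝ → ℝ, ContinuousOn F (Set.Ici 0) → (∃ R : ℝ, ∀ x, R < x → F x = 0) →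
    Tendsto (fun n : ℕ => 1 / ((n : ℝ) + 1) * ∑ j, F (σ (A n) j)) atTop
      (𝓝 (1 / (2 * π) * ∫ θ in Set.Ioo (-π) π, F ‖Q θ‖))

/-- The number of eigenvalues of the symmetric matrix `A`, with multiplicity, in `[δ, ∞)`. -/
def eigenvalueCount {n : ℕ} {A : Matrix (Fin (n + 1)) (Fin (n + 1)) ℝ} (hA : A.IsHermitian)
    (δ : ℝ) : ℕ :=
  Nat.card {j : Fin (n + 1) // δ ≤ hA.eigenvalues j}

/-- The number of singular values of `A`, with multiplicity, in `[δ, ∞)`. -/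
def singularValueCount {n : ℕ} (A : Matrix (Fin (n + 1)) (Fin (n + 1)) ℝ) (δ : ℝ) : ℕ :=
  Nat.card {j : Fin (n + 1) // δ ≤ σ A j}

end ToeplitzHankel

end

/-!
The matrices `C_n` are symmetric, so their singular values are the absolute values of their
eigenvalues, and the limit distribution of the eigenvalues can be computed by the method of moments.

The normalized trace of `C_n ^ k` converges to the `k`-th moment of the symbol `Q`. Matrices are
compared through the sum of the absolute values of their entries, `entrySum`. The Hankel part has
bounded `entrySum`, because `∑ (k + 1) |h_k|` is finite (`entrySum_gHankel_le`). The product of two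
Toeplitz matrices differs from the Toeplitz matrix of the convolution by a matrix of bounded
`entrySum`, because `∑ |m| |c_m|` is finite (`entrySum_toeplitz_mul_sub_le`). By induction `C_n ^ k`
is the Toeplitz matrix of the `k`-th convolution power of `c` up to bounded `entrySum`
(`exists_entrySum_pow_sub_le`), so the normalized trace tends to the central element of that
convolution power, which is the mean of `Q ^ k` over a period (`integral_pow_eq_convPow`). The
spectra lie in a fixed compact interval by Gershgorin's theorem, and Weierstrass approximation
passes from powers to continuous test functions (`equidistributedAs_of_moments`).

Up to a factor, `Q` is a sum of four Jacobi theta functions on the real axis. The functional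
equation, that is Poisson summation, shows that `Q` is positive (`exists_symbol_eq_pos`). Hence
eigenvalues and singular values have the same limit distribution, and the levels of `|Q|` are those
of `Q`. Moreover `Q` is the restriction of an entire function. It is not constant: by a
recurrence argument `cos (η₁ m)` and `cos (η₂ m)` are both positive at some integer `m > 0`, so that
the Fourier coefficient `c_m` is positive (`exists_realSymbol_ne`). So all level sets of `Q`
are null sets (`volume_realSymbol_eq_zero`), and the portmanteau theorem extends the convergence to threshold
functions (`EquidistributedAs.tendsto_indicator`).
-/

noncomputable section

namespace ToeplitzHankel

/-! ### Eigenvalues and singular values of symmetric matrices -/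

section Spectral

variable {n : ℕ} {A : Matrix (Fin (n + 1)) (Fin (n + 1)) ℝ}

theorem pow_eq_conjStarAlgAut (hA : A.IsHermitian) (k : ℕ) :
    A ^ k = Unitary.conjStarAlgAut ℝ _ hA.eigenvectorUnitary
      (Matrix.diagonal fun i => hA.eigenvalues i ^ k) := by
  conv_lhs => rw [hA.spectral_theorem, ← map_pow, Matrix.diagonal_pow]
  rfl

open Polynomial in
theorem charpoly_pow (hA : A.IsHermitian) (k : ℕ) :
    (A ^ k).charpoly = ∏ i, (X - C (hA.eigenvalues i ^ k)) := by
  rw [pow_eq_conjStarAlgAut hA, Unitary.conjStarAlgAut_apply, Matrix.charpoly_mul_comm, ← mul_assoc]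
  simp [Matrix.charpoly_diagonal]

theorem trace_pow (hA : A.IsHermitian) (k : ℕ) :
    (A ^ k).trace = ∑ i, hA.eigenvalues i ^ k := by
  rw [pow_eq_conjStarAlgAut hA, Unitary.conjStarAlgAut_apply, Matrix.trace_mul_comm, ← mul_assoc]
  simp [Matrix.trace_diagonal]

theorem adjoint_comp_toEuclideanLin (hA : A.IsHermitian) :
    (Matrix.toEuclideanLin A).adjoint ∘ₗ Matrix.toEuclideanLin A
      = Matrix.toEuclideanLin (A ^ 2) := by
  rw [← Matrix.toEuclideanLin_conjTranspose_eq_adjoint, hA.eq]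
  ext1 v
  simp [pow_two, Matrix.toLpLin_apply, Matrix.mulVec_mulVec]

theorem charpoly_toEuclideanLin (B : Matrix (Fin (n + 1)) (Fin (n + 1)) ℝ) :
    (Matrix.toEuclideanLin B).charpoly = B.charpoly := by
  rw [Matrix.toEuclideanLin_eq_toLin_orthonormal, Matrix.charpoly_toLin]

open Polynomial in
/-- The squares of the singular values are the eigenvalues of `A²`, so that the singular values of
a symmetric matrix are the absolute values of its eigenvalues, with the same multiplicities. -/
theorem map_singularValues_eq (hA : A.IsHermitian) :
    Multiset.map (σ A) Finset.univ.val
      = Multiset.map (fun i => |hA.eigenvalues i|) Finset.univ.val := by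
  have hs := (Matrix.toEuclideanLin A).isSymmetric_adjoint_comp_self
  have hd : Module.finrank ℝ (EuclideanSpace ℝ (Fin (n + 1))) = n + 1 := finrank_euclideanSpace_fin
  have hc : ((Matrix.toEuclideanLin A).adjoint ∘ₗ Matrix.toEuclideanLin A).charpoly
      = ∏ i, (X - C (hA.eigenvalues i ^ 2)) := by
    rw [adjoint_comp_toEuclideanLin hA, charpoly_toEuclideanLin, charpoly_pow hA]
  have h1 := hs.roots_charpoly_eq_eigenvalues hd
  rw [hc, Polynomial.roots_prod _ _
    (Finset.prod_ne_zero_iff.2 fun i _ => Polynomial.X_sub_C_ne_zero _)] at h1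
  have h2 := congrArg (Multiset.map Real.sqrt) h1
  simp only [Polynomial.roots_X_sub_C, Multiset.bind_singleton, Multiset.map_map,
    Function.comp_def, Real.sqrt_sq_eq_abs] at h2
  rw [h2]
  refine Multiset.map_congr rfl fun i _ => ?_
  exact (Matrix.toEuclideanLin A).singularValues_fin hd i

theorem sum_singularValues_eq (hA : A.IsHermitian) (F : ℝ → ℝ) :
    ∑ j, F (σ A j) = ∑ j, F |hA.eigenvalues j| := by
  have h := congrArg (fun s => (Multiset.map F s).sum) (map_singularValues_eq hA)
  simp only [Multiset.map_map, Function.comp_def] at h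
  exact h

theorem exists_singularValue_eq (hA : A.IsHermitian) (j : Fin (n + 1)) :
    ∃ i, σ A j = |hA.eigenvalues i| := by
  have h : σ A j ∈ Multiset.map (σ A) Finset.univ.val :=
    Multiset.mem_map_of_mem _ (Finset.mem_univ j)
  rw [map_singularValues_eq hA] at h
  obtain ⟨i, -, hi⟩ := Multiset.mem_map.1 h
  exact ⟨i, hi.symm⟩

theorem singularValue_nonneg (B : Matrix (Fin (n + 1)) (Fin (n + 1)) ℝ) (j : Fin (n + 1)) :
    0 ≤ σ B j :=
  LinearMap.singularValues_nonneg _ _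

/-- Gershgorin's bound: the eigenvalues are bounded by the largest absolute row sum. -/
theorem abs_eigenvalue_le (hA : A.IsHermitian) {M : ℝ} (hM : ∀ i, ∑ j, |A i j| ≤ M)
    (i : Fin (n + 1)) : |hA.eigenvalues i| ≤ M := by
  have hev : Module.End.HasEigenvalue (Matrix.toLin' A) (hA.eigenvalues i) := by
    rw [Module.End.hasEigenvalue_iff_mem_spectrum, Matrix.spectrum_toLin']
    exact hA.eigenvalues_mem_spectrum_real i
  obtain ⟨k, hk⟩ := eigenvalue_mem_ball hev
  rw [mem_closedBall_iff_norm, Real.norm_eq_abs] at hk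
  have h1 := hM k
  rw [← Finset.add_sum_erase _ _ (Finset.mem_univ k)] at h1
  have h2 : |hA.eigenvalues i| ≤ |A k k| + |hA.eigenvalues i - A k k| := by
    have := abs_add_le (A k k) (hA.eigenvalues i - A k k)
    rwa [add_sub_cancel] at this
  simp only [Real.norm_eq_abs] at hk
  linarith

theorem singularValue_le (hA : A.IsHermitian) {M : ℝ} (hM : ∀ i, ∑ j, |A i j| ≤ M)
    (j : Fin (n + 1)) : σ A j ≤ M := by
  obtain ⟨i, hi⟩ := exists_singularValue_eq hA j
  exact hi ▸ abs_eigenvalue_le hA hM i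

end Spectral

/-! ### Matrices up to a bounded entrywise absolute sum -/

section EntrySum

variable {n : ℕ}

/-- The sum of the absolute values of all entries. Two sequences of matrices whose difference has
bounded `entrySum` have the same normalized traces in the limit. -/
def entrySum (A : Matrix (Fin (n + 1)) (Fin (n + 1)) ℝ) : ℝ := ∑ i, ∑ j, |A i j|

theorem entrySum_add_le (A B : Matrix (Fin (n + 1)) (Fin (n + 1)) ℝ) :
    entrySum (A + B) ≤ entrySum A + entrySum B := by
  simp only [entrySum, ← Finset.sum_add_distrib]
  exact Finset.sum_le_sum fun i _ => Finset.sum_le_sum fun j _ => abs_add_le _ _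

theorem entrySum_transpose (A : Matrix (Fin (n + 1)) (Fin (n + 1)) ℝ) :
    entrySum A.transpose = entrySum A :=
  Finset.sum_comm

theorem abs_trace_le_entrySum (A : Matrix (Fin (n + 1)) (Fin (n + 1)) ℝ) :
    |A.trace| ≤ entrySum A := by
  refine (Finset.abs_sum_le_sum_abs _ _).trans (Finset.sum_le_sum fun i _ => ?_)
  exact Finset.single_le_sum (f := fun j => |A i j|) (fun _ _ => abs_nonneg _) (Finset.mem_univ i)

theorem entrySum_mul_le (A B : Matrix (Fin (n + 1)) (Fin (n + 1)) ℝ) :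
    entrySum (A * B) ≤ ∑ k, (∑ i, |A i k|) * ∑ j, |B k j| := by
  have h : ∀ i j, |(A * B) i j| ≤ ∑ k, |A i k| * |B k j| := fun i j => by
    rw [Matrix.mul_apply]
    exact (Finset.abs_sum_le_sum_abs _ _).trans_eq (Finset.sum_congr rfl fun k _ => abs_mul _ _)
  calc entrySum (A * B) ≤ ∑ i, ∑ j, ∑ k, |A i k| * |B k j| :=
        Finset.sum_le_sum fun i _ => Finset.sum_le_sum fun j _ => h i j
    _ = ∑ i, ∑ k, ∑ j, |A i k| * |B k j| := Finset.sum_congr rfl fun i _ => Finset.sum_comm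
    _ = ∑ k, ∑ i, ∑ j, |A i k| * |B k j| := Finset.sum_comm
    _ = _ := by simp only [Finset.sum_mul_sum]

theorem entrySum_mul_le_of_col_le {A : Matrix (Fin (n + 1)) (Fin (n + 1)) ℝ} {M : ℝ}
    (hA : ∀ k, ∑ i, |A i k| ≤ M) (B : Matrix (Fin (n + 1)) (Fin (n + 1)) ℝ) :
    entrySum (A * B) ≤ M * entrySum B := by
  refine (entrySum_mul_le A B).trans ?_
  rw [entrySum, Finset.mul_sum]
  exact Finset.sum_le_sum fun k _ =>
    mul_le_mul_of_nonneg_right (hA k) (Finset.sum_nonneg fun _ _ => abs_nonneg _)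

theorem entrySum_mul_le_of_row_le (A : Matrix (Fin (n + 1)) (Fin (n + 1)) ℝ) {M : ℝ}
    {B : Matrix (Fin (n + 1)) (Fin (n + 1)) ℝ} (hB : ∀ k, ∑ j, |B k j| ≤ M) :
    entrySum (A * B) ≤ entrySum A * M := by
  refine (entrySum_mul_le A B).trans ?_
  rw [← entrySum_transpose, entrySum, Finset.sum_mul]
  exact Finset.sum_le_sum fun k _ =>
    mul_le_mul_of_nonneg_left (hB k) (Finset.sum_nonneg fun _ _ => abs_nonneg _)

end EntrySum

theorem sum_comp_le_tsum {ι κ : Type*} [Fintype ι] {f : κ → ℝ} (hf : Summable f)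
    (hf0 : ∀ k, 0 ≤ f k) {e : ι → κ} (he : Function.Injective e) :
    ∑ i, f (e i) ≤ ∑' k, f k := by
  have h := hf.sum_le_tsum (Finset.univ.map ⟨e, he⟩) fun k _ => hf0 k
  rwa [Finset.sum_map] at h

/-! ### Products of Toeplitz matrices -/

section Toeplitz

variable {a b : ℤ → ℝ}

theorem toeplitz_row_le (ha : Summable fun m => |a m|) (n : ℕ) (j : Fin (n + 1)) :
    ∑ l, |toeplitz a n j l| ≤ ∑' m, |a m| :=
  sum_comp_le_tsum (e := fun l : Fin (n + 1) => (j : ℤ) - (l : ℤ)) ha (fun _ => abs_nonneg _)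
    fun x y h => by
      have h' : (j : ℤ) - (x : ℤ) = (j : ℤ) - (y : ℤ) := h
      exact Fin.ext (by omega)

/-- The convolution of two sequences indexed by `ℤ`. -/
def conv (a b : ℤ → ℝ) (m : ℤ) : ℝ := ∑' i, a (m - i) * b i

/-- The shear `(m, i) ↦ (m - i, i)` of `ℤ × ℤ`. -/
def shear : ℤ × ℤ ≃ ℤ × ℤ where
  toFun x := (x.1 - x.2, x.2)
  invFun x := (x.1 + x.2, x.2)
  left_inv x := by simp
  right_inv x := by simp

theorem summable_shear (ha : Summable fun m => |a m|) (hb : Summable fun m => |b m|) :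
    Summable fun x : ℤ × ℤ => |a (x.1 - x.2) * b x.2| := by
  have h := ha.mul_of_nonneg hb (fun _ => abs_nonneg _) (fun _ => abs_nonneg _)
  have h2 := (shear.summable_iff).2 h
  simpa only [Function.comp_def, shear, Equiv.coe_fn_mk, ← abs_mul] using h2

theorem summable_conv_term (ha : Summable fun m => |a m|) (hb : Summable fun m => |b m|) (m : ℤ) :
    Summable fun i => |a (m - i) * b i| :=
  (summable_shear ha hb).prod_factor m

theorem summable_abs_conv (ha : Summable fun m => |a m|) (hb : Summable fun m => |b m|) :
    Summable fun m => |conv a b m| := by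
  have h : Summable fun m => ∑' i, |a (m - i) * b i| := (summable_shear ha hb).prod
  refine Summable.of_nonneg_of_le (fun _ => abs_nonneg _) (fun m => ?_) h
  exact norm_tsum_le_tsum_norm (f := fun i => a (m - i) * b i) (summable_conv_term ha hb m)

/-- Entrywise, the product of two Toeplitz matrices misses from the Toeplitz matrix of the
convolution only the terms whose intermediate index is outside `{0, …, n}`. -/
theorem abs_toeplitz_mul_sub_le (ha : Summable fun m => |a m|) (hb : Summable fun m => |b m|)
    (n : ℕ) (j l : Fin (n + 1)) :
    |(toeplitz a n * toeplitz b n - toeplitz (conv a b) n) j l| ≤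
      ∑' i : ℤ, (Set.Icc (0 : ℤ) n)ᶜ.indicator (fun i => |a (j - i)| * |b (i - l)|) i := by
  have hs : Summable fun i : ℤ => |a (j - i) * b (i - l)| := by
    have h := (Equiv.subRight (l : ℤ)).summable_iff.2 (summable_conv_term ha hb ((j : ℤ) - l))
    simpa [Function.comp_def] using h
  have hconv : conv a b ((j : ℤ) - l) = ∑' i : ℤ, a (j - i) * b (i - l) := by
    rw [conv, ← (Equiv.subRight (l : ℤ)).tsum_eq]
    simp
  have hfin : ∑ k : Fin (n + 1), a (j - (k : ℤ)) * b ((k : ℤ) - l)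
      = ∑' i : ℤ, (Set.Icc (0 : ℤ) n).indicator (fun i => a (j - i) * b (i - l)) i := by
    rw [← Finset.coe_Icc, ← sum_eq_tsum_indicator]
    refine Finset.sum_bij (fun k _ => (k : ℤ)) (fun k _ => ?_) (fun x _ y _ h => ?_)
      (fun i hi => ?_) (fun _ _ => rfl)
    · have := k.isLt
      simp only [Finset.mem_Icc]; omega
    · exact Fin.ext (by exact_mod_cast h)
    · rw [Finset.mem_Icc] at hi
      exact ⟨⟨i.toNat, by omega⟩, Finset.mem_univ _, by simp [hi.1]⟩
  have hs' : Summable fun i : ℤ => a (j - i) * b (i - l) := hs.of_abs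
  have hsub : (toeplitz a n * toeplitz b n - toeplitz (conv a b) n) j l
      = -∑' i : ℤ, (Set.Icc (0 : ℤ) n)ᶜ.indicator (fun i => a (j - i) * b (i - l)) i := by
    rw [Matrix.sub_apply, Matrix.mul_apply]
    simp only [toeplitz, Matrix.of_apply]
    rw [hfin, hconv, ← Summable.tsum_sub (hs'.indicator _) hs', ← tsum_neg]
    refine tsum_congr fun i => ?_
    rw [← Set.indicator_self_add_compl (Set.Icc (0 : ℤ) n) (fun i => a (j - i) * b (i - l))]
    by_cases hi : i ∈ Set.Icc (0 : ℤ) n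
    · simp [hi]
    · simp [hi]
  rw [hsub, abs_neg, ← Real.norm_eq_abs]
  refine (norm_tsum_le_tsum_norm (hs'.indicator _).norm).trans_eq (tsum_congr fun i => ?_)
  rw [norm_indicator_eq_indicator_norm]
  simp only [Real.norm_eq_abs, abs_mul]

/-- At most `|m|` points of `{0, …, n}` leave this interval under the shift by `-m`. -/
theorem card_leave_le (n : ℕ) (m : ℤ) :
    ∑ j : Fin (n + 1), (Set.Icc (0 : ℤ) n)ᶜ.indicator (fun _ => (1 : ℝ)) ((j : ℤ) - m)
      ≤ |(m : ℝ)| := by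
  have hcard : (Finset.univ.filter fun j : Fin (n + 1) => (j : ℤ) - m ∉ Set.Icc (0 : ℤ) n).card
      ≤ m.natAbs := by
    rcases le_total 0 m with hm | hm
    · rw [← Finset.card_range m.natAbs]
      refine Finset.card_le_card_of_injOn (fun j => (j : ℕ)) (fun j hj => ?_)
        (fun x _ y _ h => Fin.ext h)
      have hj' := (Finset.mem_filter.1 hj).2
      have := j.isLt
      rw [Set.mem_Icc] at hj'
      simp only [Finset.coe_range, Set.mem_Iio]
      omega
    · -- For `m ≤ 0` the points that leave are the last `|m|` ones.
      rw [← Finset.card_range m.natAbs]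
      refine Finset.card_le_card_of_injOn (fun j => n - (j : ℕ)) (fun j hj => ?_)
        (fun x _ y _ h => Fin.ext ?_)
      · have hj' := (Finset.mem_filter.1 hj).2
        have := j.isLt
        rw [Set.mem_Icc] at hj'
        simp only [Finset.coe_range, Set.mem_Iio]
        omega
      · have := x.isLt
        have := y.isLt
        have h' : n - (x : ℕ) = n - (y : ℕ) := h
        omega
  have h1 : ∑ j : Fin (n + 1), (Set.Icc (0 : ℤ) n)ᶜ.indicator (fun _ => (1 : ℝ)) ((j : ℤ) - m)
      = ((Finset.univ.filter fun j : Fin (n + 1) => (j : ℤ) - m ∉ Set.Icc (0 : ℤ) n).card : ℝ) := by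
    rw [Finset.card_filter, Nat.cast_sum]
    refine Finset.sum_congr rfl fun j _ => ?_
    by_cases hj : (j : ℤ) - m ∈ Set.Icc (0 : ℤ) n <;> simp [hj]
  rw [h1, ← Int.cast_abs, Int.abs_eq_natAbs, Int.cast_natCast]
  exact_mod_cast hcard

/-- The Toeplitz matrix of a convolution is the product of the Toeplitz matrices up to the paths
`j → i → l` with `i` outside `{0, …, n}`. A step of length `m` leaves that interval from at most
`|m|` starting points, which makes the error bounded independently of `n`. -/
theorem entrySum_toeplitz_mul_sub_le (ha : Summable fun m => |a m|)
    (ha' : Summable fun m : ℤ => |(m : ℝ)| * |a m|) (hb : Summable fun m => |b m|) (n : ℕ) :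
    entrySum (toeplitz a n * toeplitz b n - toeplitz (conv a b) n)
      ≤ (∑' m : ℤ, |(m : ℝ)| * |a m|) * ∑' m, |b m| := by
  have hsj : ∀ j : ℤ, Summable fun i : ℤ => |a (j - i)| := fun j => by
    simpa [Function.comp_def] using (Equiv.subLeft j).summable_iff.2 ha
  have hb0 : 0 ≤ ∑' m, |b m| := tsum_nonneg fun _ => abs_nonneg _
  have hb1 : ∀ m, |b m| ≤ ∑' m, |b m| := fun m => hb.le_tsum m fun _ _ => abs_nonneg _
  have hterm : ∀ (j l : ℤ), Summable
      ((Set.Icc (0 : ℤ) n)ᶜ.indicator fun i => |a (j - i)| * |b (i - l)|) := fun j l =>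
    (Summable.of_nonneg_of_le (fun _ => by positivity)
      (fun i => mul_le_mul_of_nonneg_left (hb1 (i - l)) (abs_nonneg _))
      ((hsj j).mul_right _)).indicator _
  have hrow : ∀ j : Fin (n + 1),
      ∑ l, |(toeplitz a n * toeplitz b n - toeplitz (conv a b) n) j l| ≤
        ∑' m : ℤ, (Set.Icc (0 : ℤ) n)ᶜ.indicator (fun _ => (1 : ℝ)) ((j : ℤ) - m)
          * (|a m| * ∑' m, |b m|) := fun j => by
    calc _ ≤ ∑ l : Fin (n + 1), ∑' i : ℤ,
          (Set.Icc (0 : ℤ) n)ᶜ.indicator (fun i => |a (j - i)| * |b (i - l)|) i :=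
          Finset.sum_le_sum fun l _ => abs_toeplitz_mul_sub_le ha hb n j l
      _ = ∑' i : ℤ, ∑ l : Fin (n + 1),
          (Set.Icc (0 : ℤ) n)ᶜ.indicator (fun i => |a (j - i)| * |b (i - l)|) i :=
          (Summable.tsum_finsetSum fun (l : Fin (n + 1)) _ => hterm (j : ℤ) (l : ℤ)).symm
      _ ≤ ∑' i : ℤ, (Set.Icc (0 : ℤ) n)ᶜ.indicator (fun i => |a (j - i)| * ∑' m, |b m|) i := by
          refine Summable.tsum_le_tsum (fun i => ?_)
            (summable_sum fun (l : Fin (n + 1)) _ => hterm (j : ℤ) (l : ℤ))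
            (((hsj j).mul_right _).indicator _)
          by_cases hi : i ∈ (Set.Icc (0 : ℤ) n)ᶜ
          · simp only [Set.indicator_of_mem hi, ← Finset.mul_sum]
            refine mul_le_mul_of_nonneg_left ?_ (abs_nonneg _)
            exact sum_comp_le_tsum (e := fun l : Fin (n + 1) => i - (l : ℤ)) hb
              (fun _ => abs_nonneg _) fun x y h => by
                have h' : i - (x : ℤ) = i - (y : ℤ) := h
                exact Fin.ext (by omega)
          · simp [Set.indicator_of_notMem hi]
      _ = _ := by
          rw [← (Equiv.subLeft (j : ℤ)).tsum_eq]
          refine tsum_congr fun m => ?_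
          simp [Set.indicator_apply]
  have hs2 : ∀ j : Fin (n + 1), Summable fun m : ℤ =>
      (Set.Icc (0 : ℤ) n)ᶜ.indicator (fun _ => (1 : ℝ)) ((j : ℤ) - m)
        * (|a m| * ∑' m, |b m|) := fun j => by
    refine Summable.of_nonneg_of_le (fun m => ?_) (fun m => ?_) (ha.mul_right (∑' m, |b m|))
    · exact mul_nonneg (Set.indicator_nonneg (fun _ _ => zero_le_one) _) (by positivity)
    · exact mul_le_of_le_one_left (by positivity)
        (Set.indicator_le' (fun _ _ => le_rfl) (fun _ _ => zero_le_one) _)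
  calc _ ≤ ∑ j : Fin (n + 1), ∑' m : ℤ,
        (Set.Icc (0 : ℤ) n)ᶜ.indicator (fun _ => (1 : ℝ)) ((j : ℤ) - m)
          * (|a m| * ∑' m, |b m|) := Finset.sum_le_sum fun j _ => hrow j
    _ = ∑' m : ℤ, ∑ j : Fin (n + 1),
        (Set.Icc (0 : ℤ) n)ᶜ.indicator (fun _ => (1 : ℝ)) ((j : ℤ) - m)
          * (|a m| * ∑' m, |b m|) := (Summable.tsum_finsetSum fun j _ => hs2 j).symm
    _ ≤ ∑' m : ℤ, |(m : ℝ)| * |a m| * ∑' m, |b m| := by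
        refine Summable.tsum_le_tsum (fun m => ?_) (summable_sum fun j _ => hs2 j)
          (ha'.mul_right _)
        rw [← Finset.sum_mul, mul_assoc]
        exact mul_le_mul_of_nonneg_right (card_leave_le n m) (by positivity)
    _ = _ := tsum_mul_right

/-- Convolution powers, with the unit sequence as the zeroth power. -/
def convPow (a : ℤ → ℝ) : ℕ → ℤ → ℝ
  | 0 => Pi.single 0 1
  | k + 1 => conv a (convPow a k)

theorem summable_abs_convPow (ha : Summable fun m => |a m|) (k : ℕ) :
    Summable fun m => |convPow a k m| := by
  induction k with
  | zero =>
    refine summable_of_ne_finset_zero (s := {0}) fun m hm => ?_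
    simp [convPow, Finset.notMem_singleton.1 hm]
  | succ k ih => exact summable_abs_conv ha ih

theorem toeplitz_convPow_zero (a : ℤ → ℝ) (n : ℕ) : toeplitz (convPow a 0) n = 1 := by
  ext j l
  have h : (j : ℤ) - (l : ℤ) = 0 ↔ j = l := by
    rw [sub_eq_zero]
    exact ⟨fun h => Fin.ext (by exact_mod_cast h), fun h => by rw [h]⟩
  simp [toeplitz, convPow, Pi.single_apply, Matrix.one_apply, h]

/-- Powers of a matrix sequence `A n` that is a bounded perturbation, in the sense of `entrySum`,
of Toeplitz matrices are bounded perturbations of the Toeplitz matrices of the convolution powers.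
-/
theorem exists_entrySum_pow_sub_le (ha : Summable fun m => |a m|)
    (ha' : Summable fun m : ℤ => |(m : ℝ)| * |a m|)
    {A : ∀ n : ℕ, Matrix (Fin (n + 1)) (Fin (n + 1)) ℝ} {M K : ℝ} (hM : 0 ≤ M)
    (hcol : ∀ n k, ∑ i, |A n i k| ≤ M) (hK : ∀ n, entrySum (A n - toeplitz a n) ≤ K) (k : ℕ) :
    ∃ L, ∀ n, entrySum (A n ^ k - toeplitz (convPow a k) n) ≤ L := by
  induction k with
  | zero => exact ⟨0, fun n => by simp [toeplitz_convPow_zero, entrySum]⟩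
  | succ k ih =>
    obtain ⟨L, hL⟩ := ih
    have hb := summable_abs_convPow ha k
    refine ⟨M * L + K * (∑' m, |convPow a k m|)
      + (∑' m : ℤ, |(m : ℝ)| * |a m|) * ∑' m, |convPow a k m|, fun n => ?_⟩
    -- Replace the factors one at a time: first the power, then the remaining factor `A n`, and
    -- finally the product of Toeplitz matrices.
    have e : A n ^ (k + 1) - toeplitz (convPow a (k + 1)) n
        = A n * (A n ^ k - toeplitz (convPow a k) n)
          + (A n - toeplitz a n) * toeplitz (convPow a k) n
          + (toeplitz a n * toeplitz (convPow a k) n - toeplitz (conv a (convPow a k)) n) := by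
      rw [pow_succ', convPow]
      noncomm_ring
    rw [e]
    refine (entrySum_add_le _ _).trans (add_le_add ((entrySum_add_le _ _).trans
      (add_le_add ?_ ?_)) (entrySum_toeplitz_mul_sub_le ha ha' hb n))
    · exact (entrySum_mul_le_of_col_le (hcol n) _).trans (mul_le_mul_of_nonneg_left (hL n) hM)
    · exact (entrySum_mul_le_of_row_le _ (toeplitz_row_le hb n)).trans
        (mul_le_mul_of_nonneg_right (hK n) (tsum_nonneg fun _ => abs_nonneg _))

theorem trace_toeplitz (a : ℤ → ℝ) (n : ℕ) : (toeplitz a n).trace = ((n : ℝ) + 1) * a 0 := by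
  simp [Matrix.trace, toeplitz]

theorem tendsto_trace_pow (ha : Summable fun m => |a m|)
    (ha' : Summable fun m : ℤ => |(m : ℝ)| * |a m|)
    {A : ∀ n : ℕ, Matrix (Fin (n + 1)) (Fin (n + 1)) ℝ} {M K : ℝ} (hM : 0 ≤ M)
    (hcol : ∀ n k, ∑ i, |A n i k| ≤ M) (hK : ∀ n, entrySum (A n - toeplitz a n) ≤ K) (k : ℕ) :
    Tendsto (fun n : ℕ => 1 / ((n : ℝ) + 1) * (A n ^ k).trace) atTop (𝓝 (convPow a k 0)) := by
  obtain ⟨L, hL⟩ := exists_entrySum_pow_sub_le ha ha' hM hcol hK k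
  rw [tendsto_iff_norm_sub_tendsto_zero]
  have hlim : Tendsto (fun n : ℕ => L * (1 / ((n : ℝ) + 1))) atTop (𝓝 0) := by
    simpa using tendsto_one_div_add_atTop_nhds_zero_nat.const_mul L
  refine squeeze_zero (fun _ => norm_nonneg _) (fun n => ?_) hlim
  have hn : (0 : ℝ) < (n : ℝ) + 1 := by positivity
  have e : 1 / ((n : ℝ) + 1) * (A n ^ k).trace - convPow a k 0
      = (A n ^ k - toeplitz (convPow a k) n).trace * (1 / ((n : ℝ) + 1)) := by
    rw [Matrix.trace_sub, trace_toeplitz]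
    field_simp
  rw [e, norm_mul, Real.norm_eq_abs, Real.norm_of_nonneg (by positivity : 0 ≤ 1 / ((n : ℝ) + 1))]
  exact mul_le_mul_of_nonneg_right ((abs_trace_le_entrySum _).trans (hL n)) (by positivity)

end Toeplitz

/-! ### The symbol of an absolutely summable sequence -/

section Symbol

variable {a b : ℤ → ℝ}

theorem norm_symbol_term (a : ℤ → ℝ) (j : ℤ) (θ : ℝ) :
    ‖(a j : ℂ) * Complex.exp (Complex.I * j * θ)‖ = |a j| := by
  have e : Complex.I * j * θ = ((j * θ : ℝ) : ℂ) * Complex.I := by push_cast; ring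
  rw [norm_mul, e, Complex.norm_exp_ofReal_mul_I, mul_one, Complex.norm_real, Real.norm_eq_abs]

theorem summable_norm_symbol_term (ha : Summable fun m => |a m|) (θ : ℝ) :
    Summable fun j : ℤ => ‖(a j : ℂ) * Complex.exp (Complex.I * j * θ)‖ := by
  simpa only [norm_symbol_term] using ha

theorem norm_symbol_le (ha : Summable fun m => |a m|) (θ : ℝ) :
    ‖symbol a θ‖ ≤ ∑' m, |a m| := by
  have h := norm_tsum_le_tsum_norm (summable_norm_symbol_term ha θ)
  simp only [norm_symbol_term] at h
  exact h

theorem continuous_symbol (ha : Summable fun m => |a m|) : Continuous (symbol a) :=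
  continuous_tsum (fun j => by fun_prop) ha fun j θ => (norm_symbol_term a j θ).le

theorem symbol_conv (ha : Summable fun m => |a m|) (hb : Summable fun m => |b m|) (θ : ℝ) :
    symbol (conv a b) θ = symbol a θ * symbol b θ := by
  have e : ∀ x : ℤ × ℤ, (a (shear x).1 : ℂ) * Complex.exp (Complex.I * (shear x).1 * θ)
      * ((b (shear x).2 : ℂ) * Complex.exp (Complex.I * (shear x).2 * θ))
      = ((a (x.1 - x.2) * b x.2 : ℝ) : ℂ) * Complex.exp (Complex.I * x.1 * θ) := fun x => by
    have : Complex.I * x.1 * θ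
        = Complex.I * ((x.1 - x.2 : ℤ) : ℂ) * θ + Complex.I * x.2 * θ := by
      push_cast; ring
    rw [this, Complex.exp_add]
    simp only [shear, Equiv.coe_fn_mk]
    push_cast
    ring
  have hs : Summable fun x : ℤ × ℤ =>
      ((a (x.1 - x.2) * b x.2 : ℝ) : ℂ) * Complex.exp (Complex.I * x.1 * θ) := by
    refine Summable.of_norm ?_
    have h : ∀ x : ℤ × ℤ,
        ‖((a (x.1 - x.2) * b x.2 : ℝ) : ℂ) * Complex.exp (Complex.I * x.1 * θ)‖
        = |a (x.1 - x.2) * b x.2| := fun x =>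
      norm_symbol_term (fun _ => a (x.1 - x.2) * b x.2) x.1 θ
    simpa only [h] using summable_shear ha hb
  rw [symbol, symbol, symbol, tsum_mul_tsum_of_summable_norm (summable_norm_symbol_term ha θ)
    (summable_norm_symbol_term hb θ), ← shear.tsum_eq, tsum_congr e, hs.tsum_prod]
  refine tsum_congr fun m => ?_
  change _ = ∑' i, ((a (m - i) * b i : ℝ) : ℂ) * Complex.exp (Complex.I * m * θ)
  rw [tsum_mul_right, ← Complex.ofReal_tsum, conv]

theorem symbol_convPow (ha : Summable fun m => |a m|) (k : ℕ) (θ : ℝ) :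
    symbol (convPow a k) θ = symbol a θ ^ k := by
  induction k with
  | zero =>
    rw [symbol, tsum_eq_single 0 fun m hm => by simp [convPow, hm]]
    simp [convPow]
  | succ k ih =>
    rw [convPow, symbol_conv ha (summable_abs_convPow ha k), ih, pow_succ']

theorem integral_exp_int (m : ℤ) :
    ∫ θ in Set.Ioo (-π) π, Complex.exp (Complex.I * m * (θ : ℂ)) = if m = 0 then 2 * π else 0 := by
  rw [← integral_Ioc_eq_integral_Ioo,
    ← intervalIntegral.integral_of_le (by linarith [pi_pos])]
  split_ifs with h
  · simp [h]; ring
  · have hc : Complex.I * m ≠ 0 := by simp [h]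
    rw [integral_exp_mul_complex hc]
    -- The primitive is `2π`-periodic, so the boundary terms cancel.
    have e : Complex.I * m * (π : ℝ)
        = Complex.I * m * ((-π : ℝ) : ℂ) + m * (2 * π * Complex.I) := by
      push_cast; ring
    rw [e, Complex.exp_add, Complex.exp_int_mul_two_pi_mul_I]
    simp

/-- The elements of an absolutely summable sequence are the Fourier coefficients of its symbol. -/
theorem integral_symbol_mul_exp (ha : Summable fun m => |a m|) (m : ℤ) :
    ∫ θ in Set.Ioo (-π) π, symbol a θ * Complex.exp (Complex.I * (-m : ℤ) * (θ : ℂ))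
      = 2 * π * a m := by
  have hterm : ∀ (j : ℤ) (θ : ℝ), (a j : ℂ) * Complex.exp (Complex.I * j * θ)
      * Complex.exp (Complex.I * (-m : ℤ) * θ)
      = a j * Complex.exp (Complex.I * (j - m : ℤ) * θ) := fun j θ => by
    rw [mul_assoc, ← Complex.exp_add]
    congr 2
    push_cast; ring
  have hnorm : ∀ (j : ℤ) (θ : ℝ), ‖(a j : ℂ) * Complex.exp (Complex.I * (j - m : ℤ) * θ)‖
      = |a j| := fun j θ => norm_symbol_term (fun _ => a j) (j - m) θ
  have hint : ∀ j : ℤ, Integrable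
      (fun θ : ℝ => (a j : ℂ) * Complex.exp (Complex.I * (j - m : ℤ) * θ))
      (volume.restrict (Set.Ioo (-π) π)) := fun j =>
    (Continuous.integrableOn_Icc (by fun_prop)).mono_set Set.Ioo_subset_Icc_self
  have h := hasSum_integral_of_summable_integral_norm hint (by
    simp only [hnorm, integral_const, smul_eq_mul]
    exact ha.mul_left _)
  simp only [symbol, ← tsum_mul_right, hterm]
  rw [← h.tsum_eq, tsum_eq_single m fun j hj => ?_]
  · rw [integral_const_mul, integral_exp_int]
    simp; ring
  · rw [integral_const_mul, integral_exp_int, if_neg (sub_ne_zero.2 hj), Complex.ofReal_zero,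
      mul_zero]

theorem integral_symbol (ha : Summable fun m => |a m|) :
    ∫ θ in Set.Ioo (-π) π, symbol a θ = 2 * π * a 0 := by
  simpa using integral_symbol_mul_exp ha 0

/-- The moments of a real symbol are the central elements of the convolution powers. -/
theorem integral_pow_eq_convPow (ha : Summable fun m => |a m|) {q : ℝ → ℝ}
    (hq : ∀ θ, symbol a θ = q θ) (k : ℕ) :
    1 / (2 * π) * ∫ θ in Set.Ioo (-π) π, q θ ^ k = convPow a k 0 := by
  have h := integral_symbol (summable_abs_convPow ha k)
  simp only [symbol_convPow ha, hq, ← Complex.ofReal_pow] at h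
  have h' : ∫ θ in Set.Ioo (-π) π, q θ ^ k = 2 * π * convPow a k 0 := by
    exact_mod_cast (integral_complex_ofReal (f := fun θ => q θ ^ k)).symm.trans h
  rw [h']
  field_simp

end Symbol

/-! ### Equidistribution of triangular arrays -/

section Equidistribution

/-- The triangular array `x n 0, …, x n n` is asymptotically distributed as the function `q` on
`(-π, π)`: averages of continuous functions over the `n`-th row converge to averages over `q`. -/
def EquidistributedAs (x : ∀ n : ℕ, Fin (n + 1) → ℝ) (q : ℝ → ℝ) : Prop :=
  ∀ F : ℝ → ℝ, Continuous F →
    Tendsto (fun n : ℕ => 1 / ((n : ℝ) + 1) * ∑ j, F (x n j)) atTop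
      (𝓝 (1 / (2 * π) * ∫ θ in Set.Ioo (-π) π, F (q θ)))

variable {x : ∀ n : ℕ, Fin (n + 1) → ℝ} {q : ℝ → ℝ}

theorem integrable_comp_Ioo (hq : Continuous q) {F : ℝ → ℝ} (hF : Continuous F) :
    Integrable (fun θ => F (q θ)) (volume.restrict (Set.Ioo (-π) π)) :=
  ((hF.comp hq).integrableOn_Icc).mono_set Set.Ioo_subset_Icc_self

theorem abs_average_sub_le {n : ℕ} {y : Fin (n + 1) → ℝ} {F G : ℝ → ℝ} {ε : ℝ}
    (h : ∀ j, |F (y j) - G (y j)| ≤ ε) :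
    |1 / ((n : ℝ) + 1) * ∑ j, F (y j) - 1 / ((n : ℝ) + 1) * ∑ j, G (y j)| ≤ ε := by
  have hn : (0 : ℝ) < (n : ℝ) + 1 := by positivity
  rw [← mul_sub, ← Finset.sum_sub_distrib, abs_mul, abs_of_pos (by positivity), one_div,
    inv_mul_le_iff₀ hn]
  refine (Finset.abs_sum_le_sum_abs _ _).trans ((Finset.sum_le_sum fun j _ => h j).trans_eq ?_)
  simp

theorem abs_mean_integral_sub_le (hq : Continuous q) {F G : ℝ → ℝ} (hF : Continuous F)
    (hG : Continuous G) {ε : ℝ} (h : ∀ θ, |F (q θ) - G (q θ)| ≤ ε) :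
    |1 / (2 * π) * (∫ θ in Set.Ioo (-π) π, F (q θ))
      - 1 / (2 * π) * ∫ θ in Set.Ioo (-π) π, G (q θ)| ≤ ε := by
  have hpi : 0 < 2 * π := by positivity
  rw [← mul_sub, ← integral_sub (integrable_comp_Ioo hq hF) (integrable_comp_Ioo hq hG), abs_mul,
    abs_of_pos (by positivity), one_div, inv_mul_le_iff₀ hpi]
  have := norm_setIntegral_le_of_norm_le_const (μ := volume) (s := Set.Ioo (-π) π) (C := ε)
    (f := fun θ => F (q θ) - G (q θ)) (by simp) fun θ _ => h θ
  refine this.trans_eq ?_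
  rw [Real.volume_real_Ioo_of_le (by linarith [pi_pos])]
  ring

/-- The method of moments: by the Weierstrass approximation theorem, convergence of all moments of
a uniformly bounded array implies equidistribution. -/
theorem equidistributedAs_of_moments (hq : Continuous q) {M : ℝ} (hx : ∀ n j, |x n j| ≤ M)
    (hqM : ∀ θ, |q θ| ≤ M)
    (hmom : ∀ k : ℕ, Tendsto (fun n : ℕ => 1 / ((n : ℝ) + 1) * ∑ j, x n j ^ k) atTop
      (𝓝 (1 / (2 * π) * ∫ θ in Set.Ioo (-π) π, q θ ^ k))) :
    EquidistributedAs x q := by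
  have hpoly : ∀ P : Polynomial ℝ,
      Tendsto (fun n : ℕ => 1 / ((n : ℝ) + 1) * ∑ j, P.eval (x n j)) atTop
        (𝓝 (1 / (2 * π) * ∫ θ in Set.Ioo (-π) π, P.eval (q θ))) := fun P => by
    induction P using Polynomial.induction_on' with
    | add P R hP hR =>
      simp only [Polynomial.eval_add, Finset.sum_add_distrib, mul_add]
      rw [integral_add (integrable_comp_Ioo hq P.continuous)
        (integrable_comp_Ioo hq R.continuous), mul_add]
      exact hP.add hR
    | monomial k r =>
      simp only [Polynomial.eval_monomial, ← Finset.mul_sum, integral_const_mul]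
      simpa only [mul_left_comm] using (hmom k).const_mul r
  intro F hF
  rw [Metric.tendsto_atTop]
  intro ε hε
  obtain ⟨P, hP⟩ := exists_polynomial_near_of_continuousOn (-M) M F hF.continuousOn (ε / 4)
    (by positivity)
  obtain ⟨N, hN⟩ := Metric.tendsto_atTop.1 (hpoly P) (ε / 4) (by positivity)
  refine ⟨N, fun n hn => ?_⟩
  have h1 := hN n hn
  have h2 := abs_average_sub_le (y := x n) (F := fun t => P.eval t) (G := F)
    fun j => (hP _ (abs_le.1 (hx n j))).le
  have h3 := abs_mean_integral_sub_le hq P.continuous hF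
    fun θ => (hP _ (abs_le.1 (hqM θ))).le
  rw [Real.dist_eq] at h1 ⊢
  rw [abs_lt] at h1 ⊢
  rw [abs_le] at h2 h3
  constructor <;> linarith [h1.1, h1.2, h2.1, h2.2, h3.1, h3.2]

/-- The uniform probability measure on the points of a row of the array. -/
def rowMeasure {n : ℕ} (y : Fin (n + 1) → ℝ) : ProbabilityMeasure ℝ :=
  ⟨(PMF.uniformOfFintype (Fin (n + 1))).toMeasure.map y,
    Measure.isProbabilityMeasure_map (by fun_prop)⟩

theorem integral_rowMeasure {n : ℕ} (y : Fin (n + 1) → ℝ) {F : ℝ → ℝ} (hF : Measurable F) :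
    ∫ t, F t ∂(rowMeasure y : Measure ℝ) = 1 / ((n : ℝ) + 1) * ∑ j, F (y j) := by
  have h : ∫ t, F t ∂(rowMeasure y : Measure ℝ)
      = ∫ j, F (y j) ∂(PMF.uniformOfFintype (Fin (n + 1))).toMeasure :=
    integral_map (by fun_prop) hF.aestronglyMeasurable
  rw [h, PMF.integral_eq_sum, Finset.mul_sum]
  refine Finset.sum_congr rfl fun j _ => ?_
  have e : (((n + 1 : ℕ) : ENNReal)).toReal = (n : ℝ) + 1 := by
    rw [ENNReal.toReal_natCast, Nat.cast_succ]
  rw [PMF.uniformOfFintype_apply, Fintype.card_fin, ENNReal.toReal_inv, e, smul_eq_mul, one_div]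

/-- The distribution of `q` under the uniform probability measure on `(-π, π)`. -/
def symbolMeasure (q : ℝ → ℝ) (hq : Continuous q) : ProbabilityMeasure ℝ :=
  ⟨((ENNReal.ofReal (1 / (2 * π))) • volume.restrict (Set.Ioo (-π) π)).map q, by
    have : IsProbabilityMeasure
        ((ENNReal.ofReal (1 / (2 * π))) • volume.restrict (Set.Ioo (-π) π)) := ⟨by
      have h2 : π - -π = 2 * π := by ring
      rw [Measure.smul_apply, Measure.restrict_apply_univ, Real.volume_Ioo, h2, smul_eq_mul,
        ← ENNReal.ofReal_mul (by positivity), one_div_mul_cancel (by positivity),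
        ENNReal.ofReal_one]⟩
    exact Measure.isProbabilityMeasure_map hq.aemeasurable⟩

theorem integral_symbolMeasure (hq : Continuous q) {F : ℝ → ℝ} (hF : Measurable F) :
    ∫ t, F t ∂(symbolMeasure q hq : Measure ℝ)
      = 1 / (2 * π) * ∫ θ in Set.Ioo (-π) π, F (q θ) := by
  have h : ∫ t, F t ∂(symbolMeasure q hq : Measure ℝ)
      = ∫ θ, F (q θ) ∂((ENNReal.ofReal (1 / (2 * π))) • volume.restrict (Set.Ioo (-π) π)) :=
    integral_map hq.aemeasurable hF.aestronglyMeasurable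
  rw [h, integral_smul_measure, ENNReal.toReal_ofReal (by positivity), smul_eq_mul]

/-- Equidistribution is weak convergence, hence by the portmanteau theorem it extends to threshold
functions whose threshold is a level that `q` attains only on a null set. -/
theorem EquidistributedAs.tendsto_indicator (h : EquidistributedAs x q) (hq : Continuous q) {δ : ℝ}
    (hδ : volume {θ | q θ = δ} = 0) :
    Tendsto (fun n : ℕ => 1 / ((n : ℝ) + 1) *
      ∑ j, (Set.Ici δ).indicator (fun _ => (1 : ℝ)) (x n j)) atTop
      (𝓝 (1 / (2 * π) *
        ∫ θ in Set.Ioo (-π) π, (Set.Ici δ).indicator (fun _ => (1 : ℝ)) (q θ))) := by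
  have hlim : Tendsto (fun n => rowMeasure (x n)) atTop (𝓝 (symbolMeasure q hq)) := by
    rw [ProbabilityMeasure.tendsto_iff_forall_integral_tendsto]
    intro f
    simp only [integral_rowMeasure _ f.continuous.measurable,
      integral_symbolMeasure hq f.continuous.measurable]
    exact h f f.continuous
  have hnull : (symbolMeasure q hq : Measure ℝ) (frontier (Set.Ici δ)) = 0 := by
    rw [frontier_Ici]
    change Measure.map q _ {δ} = 0
    rw [Measure.map_apply hq.measurable (measurableSet_singleton δ), Measure.smul_apply,
      show q ⁻¹' {δ} = {θ | q θ = δ} from rfl,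
      Measure.absolutelyContinuous_of_le Measure.restrict_le_self hδ, smul_zero]
  have hm : Measurable ((Set.Ici δ).indicator fun _ => (1 : ℝ)) :=
    measurable_const.indicator measurableSet_Ici
  have := (ENNReal.tendsto_toReal (measure_ne_top _ _)).comp
    (ProbabilityMeasure.tendsto_measure_of_null_frontier_of_tendsto' hlim hnull)
  simp only [← integral_rowMeasure _ hm, ← integral_symbolMeasure hq hm]
  simpa only [Function.comp_def, integral_indicator_const _ measurableSet_Ici, smul_eq_mul, mul_one,
    Measure.real] using this

theorem sum_indicator_eq_card {n : ℕ} (y : Fin (n + 1) → ℝ) (δ : ℝ) :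
    1 / ((n : ℝ) + 1) * ∑ j, (Set.Ici δ).indicator (fun _ => (1 : ℝ)) (y j)
      = (Nat.card {j : Fin (n + 1) // δ ≤ y j} : ℝ) / ((n : ℝ) + 1) := by
  classical
  have e : ∑ j, (Set.Ici δ).indicator (fun _ => (1 : ℝ)) (y j)
      = (Nat.card {j : Fin (n + 1) // δ ≤ y j} : ℝ) := by
    rw [Nat.card_eq_fintype_card, Fintype.card_subtype, Finset.card_filter, Nat.cast_sum]
    refine Finset.sum_congr rfl fun j _ => ?_
    by_cases h : δ ≤ y j <;> simp [h]
  rw [e, one_div, inv_mul_eq_div]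

theorem integral_indicator_eq_volume (hq : Continuous q) (δ : ℝ) :
    ∫ θ in Set.Ioo (-π) π, (Set.Ici δ).indicator (fun _ => (1 : ℝ)) (q θ)
      = volume.real {θ : ℝ | θ ∈ Set.Ioo (-π) π ∧ δ ≤ q θ} := by
  have hm : MeasurableSet (q ⁻¹' Set.Ici δ) := hq.measurable measurableSet_Ici
  have e : (fun θ => (Set.Ici δ).indicator (fun _ => (1 : ℝ)) (q θ))
      = (q ⁻¹' Set.Ici δ).indicator fun _ => (1 : ℝ) := by
    rfl
  rw [e, integral_indicator_const _ hm, smul_eq_mul, mul_one, Measure.real,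
    Measure.restrict_apply hm, Measure.real, Set.inter_comm]
  rfl

theorem EquidistributedAs.tendsto_card (h : EquidistributedAs x q) (hq : Continuous q) {δ : ℝ}
    (hδ : volume {θ | q θ = δ} = 0) :
    Tendsto (fun n : ℕ => (Nat.card {j : Fin (n + 1) // δ ≤ x n j} : ℝ) / ((n : ℝ) + 1)) atTop
      (𝓝 (1 / (2 * π) * volume.real {θ : ℝ | θ ∈ Set.Ioo (-π) π ∧ δ ≤ q θ})) := by
  simpa only [sum_indicator_eq_card, integral_indicator_eq_volume hq] using
    h.tendsto_indicator hq hδ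

end Equidistribution

/-! ### Decay of the two sequences -/

section Decay

namespace Params

variable (p : Params)

theorem α₁_ne_zero : p.α₁ ≠ 0 := fun h => by
  have := p.ratio_neg
  simp [h] at this

theorem α₂_ne_zero : p.α₂ ≠ 0 := fun h => by
  have := p.ratio_neg
  simp [h] at this

theorem ξ₁_pos : 0 < p.ξ₁ :=
  mul_pos (mul_pos p.B_pos (abs_pos.2 p.α₁_ne_zero)) p.Δs_pos

theorem ξ₂_pos : 0 < p.ξ₂ :=
  mul_pos (mul_pos p.B_pos (abs_pos.2 p.α₂_ne_zero)) p.Δs_pos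

theorem amp_pos : 0 < p.amp :=
  div_pos (Real.sqrt_pos.2 pi_pos) (mul_pos (mul_pos two_pos p.B_pos) p.Δt_pos)

end Params

/-- A Gaussian is dominated by a two-sided exponential, by completing the square. -/
theorem gaussian_le_exp {ξ : ℝ} (hξ : 0 < ξ) (y : ℝ) :
    exp (-(ξ * y) ^ 2 / 4) ≤ exp (1 / ξ ^ 2) * exp (-|y|) := by
  rw [← Real.exp_add, Real.exp_le_exp]
  have h : 1 / ξ ^ 2 + -|y| - -(ξ * y) ^ 2 / 4 = (ξ * |y| / 2 - 1 / ξ) ^ 2 := by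
    have : (ξ * y) ^ 2 = (ξ * |y|) ^ 2 := by rw [mul_pow, mul_pow, sq_abs]
    rw [neg_div, this]
    field_simp
    ring
  nlinarith [sq_nonneg (ξ * |y| / 2 - 1 / ξ)]

theorem Params.abs_c_le (p : Params) (m : ℤ) :
    |p.c m| ≤ p.amp * (exp (1 / p.ξ₁ ^ 2) + exp (1 / p.ξ₂ ^ 2)) * exp (-|(m : ℝ)|) := by
  have h : ∀ {ξ : ℝ} (η : ℝ), 0 < ξ →
      |exp (-(ξ * m) ^ 2 / 4) * cos (η * m)| ≤ exp (1 / ξ ^ 2) * exp (-|(m : ℝ)|) := fun η hξ => by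
    rw [abs_mul, abs_of_pos (exp_pos _)]
    exact (mul_le_of_le_one_right (exp_pos _).le (abs_cos_le_one _)).trans (gaussian_le_exp hξ _)
  rw [Params.c, abs_mul, abs_of_pos p.amp_pos, mul_assoc, add_mul]
  exact mul_le_mul_of_nonneg_left
    ((abs_add_le _ _).trans (add_le_add (h p.η₁ p.ξ₁_pos) (h p.η₂ p.ξ₂_pos))) p.amp_pos.le

theorem Params.abs_h_le (p : Params) (k : ℕ) :
    |p.h k| ≤ p.amp * exp (1 / p.ξ₁ ^ 2) * exp (|p.ζ|) * exp (-(k : ℝ)) := by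
  have h1 : exp (-|(k : ℝ) + p.ζ|) ≤ exp (|p.ζ|) * exp (-(k : ℝ)) := by
    rw [← Real.exp_add, Real.exp_le_exp]
    have := abs_sub_abs_le_abs_sub (k : ℝ) (-p.ζ)
    rw [abs_neg, sub_neg_eq_add, abs_of_nonneg (Nat.cast_nonneg k)] at this
    linarith
  rw [Params.h, abs_mul, abs_of_pos p.amp_pos, abs_mul, abs_of_pos (exp_pos _), mul_assoc,
    mul_assoc]
  refine mul_le_mul_of_nonneg_left ?_ p.amp_pos.le
  calc _ ≤ exp (-(p.ξ₁ * (k + p.ζ)) ^ 2 / 4) :=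
        mul_le_of_le_one_right (exp_pos _).le (abs_cos_le_one _)
    _ ≤ exp (1 / p.ξ₁ ^ 2) * exp (-|(k : ℝ) + p.ζ|) := gaussian_le_exp p.ξ₁_pos _
    _ ≤ _ := mul_le_mul_of_nonneg_left h1 (exp_pos _).le

theorem summable_pow_mul_exp_neg_abs (k : ℕ) :
    Summable fun m : ℤ => |(m : ℝ)| ^ k * exp (-|(m : ℝ)|) := by
  have h := Real.summable_pow_mul_exp_neg_nat_mul k one_pos
  refine Summable.of_nat_of_neg ?_ ?_ <;> simpa using h

theorem Params.summable_c (p : Params) : Summable fun m => |p.c m| :=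
  Summable.of_nonneg_of_le (fun _ => abs_nonneg _) p.abs_c_le
    (by simpa using (summable_pow_mul_exp_neg_abs 0).mul_left _)

theorem Params.summable_mul_c (p : Params) : Summable fun m : ℤ => |(m : ℝ)| * |p.c m| := by
  refine Summable.of_nonneg_of_le (fun _ => by positivity)
    (fun m => mul_le_mul_of_nonneg_left (p.abs_c_le m) (abs_nonneg _)) ?_
  have h := (summable_pow_mul_exp_neg_abs 1).mul_left
    (p.amp * (exp (1 / p.ξ₁ ^ 2) + exp (1 / p.ξ₂ ^ 2)))
  simpa only [pow_one, mul_left_comm] using h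

theorem Params.summable_h (p : Params) : Summable fun k => |p.h k| :=
  Summable.of_nonneg_of_le (fun _ => abs_nonneg _) p.abs_h_le
    (by
      have h := (Real.summable_pow_mul_exp_neg_nat_mul 0 one_pos).mul_left
        (p.amp * exp (1 / p.ξ₁ ^ 2) * exp (|p.ζ|))
      simpa only [pow_zero, one_mul, neg_mul] using h)

theorem Params.summable_mul_h (p : Params) : Summable fun k : ℕ => ((k : ℝ) + 1) * |p.h k| := by
  have h1 : Summable fun k : ℕ => (k : ℝ) * |p.h k| := by
    refine Summable.of_nonneg_of_le (fun _ => by positivity)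
      (fun m => mul_le_mul_of_nonneg_left (p.abs_h_le m) (Nat.cast_nonneg _)) ?_
    have h := (Real.summable_pow_mul_exp_neg_nat_mul 1 one_pos).mul_left
      (p.amp * exp (1 / p.ξ₁ ^ 2) * exp (|p.ζ|))
    simpa only [pow_one, neg_mul, one_mul, mul_left_comm] using h
  simpa only [add_mul, one_mul] using h1.add p.summable_h

end Decay

/-! ### The Hankel perturbation -/

section Hankel

variable {g : ℕ} {h : ℕ → ℝ}

theorem gHankel_row_le (hg : 0 < g) (hh : Summable fun k => |h k|) (n : ℕ) (j : Fin (n + 1)) :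
    ∑ l, |gHankel g h n j l| ≤ ∑' k, |h k| :=
  sum_comp_le_tsum (e := fun l : Fin (n + 1) => (j : ℕ) + g * (l : ℕ)) hh (fun _ => abs_nonneg _)
    fun x y hxy => by
      have h' : (j : ℕ) + g * (x : ℕ) = (j : ℕ) + g * (y : ℕ) := hxy
      exact Fin.ext (Nat.eq_of_mul_eq_mul_left hg (by omega))

theorem gHankel_col_le (hh : Summable fun k => |h k|) (n : ℕ) (l : Fin (n + 1)) :
    ∑ j, |gHankel g h n j l| ≤ ∑' k, |h k| :=
  sum_comp_le_tsum (e := fun j : Fin (n + 1) => (j : ℕ) + g * (l : ℕ)) hh (fun _ => abs_nonneg _)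
    fun x y hxy => by
      have h' : (x : ℕ) + g * (l : ℕ) = (y : ℕ) + g * (l : ℕ) := hxy
      exact Fin.ext (by omega)

/-- Each value `h k` occurs in at most one row of each of the columns `0, …, k`, and in no other
column. -/
theorem entrySum_gHankel_le (hg : 0 < g) (hh : Summable fun k => |h k|)
    (hh' : Summable fun k : ℕ => ((k : ℝ) + 1) * |h k|) (n : ℕ) :
    entrySum (gHankel g h n) ≤ ∑' k : ℕ, ((k : ℝ) + 1) * |h k| := by
  have hcol : ∀ l : Fin (n + 1), ∑ j, |gHankel g h n j l|
      ≤ ∑' k : ℕ, (Set.Ici (l : ℕ)).indicator (fun k => |h k|) k := fun l => by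
    have h1 := sum_comp_le_tsum (e := fun j : Fin (n + 1) => (j : ℕ) + g * (l : ℕ))
      (hh.indicator (Set.Ici (l : ℕ))) (fun _ => Set.indicator_nonneg (fun _ _ => abs_nonneg _) _)
      fun x y hxy => by
        have h' : (x : ℕ) + g * (l : ℕ) = (y : ℕ) + g * (l : ℕ) := hxy
        exact Fin.ext (by omega)
    refine (Finset.sum_congr rfl fun j _ => ?_).trans_le h1
    -- Column `l` only contains values `h k` with `k ≥ g l ≥ l`.
    have hmem : (j : ℕ) + g * (l : ℕ) ∈ Set.Ici (l : ℕ) :=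
      Set.mem_Ici.2 ((Nat.le_mul_of_pos_left _ hg).trans (Nat.le_add_left _ _))
    rw [Set.indicator_of_mem hmem]
    rfl
  have hcount : ∀ k : ℕ, ∑ l : Fin (n + 1), (Set.Ici (l : ℕ)).indicator (fun k => |h k|) k
      ≤ ((k : ℝ) + 1) * |h k| := fun k => by
    have hc : (Finset.univ.filter fun l : Fin (n + 1) => (l : ℕ) ≤ k).card ≤ k + 1 := by
      rw [← Finset.card_range (k + 1)]
      refine Finset.card_le_card_of_injOn (fun l => (l : ℕ)) (fun l hl => ?_)
        fun x _ y _ hxy => Fin.ext hxy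
      have := (Finset.mem_filter.1 hl).2
      simp only [Finset.coe_range, Set.mem_Iio]
      omega
    simp only [Set.indicator_apply, Set.mem_Ici]
    rw [← Finset.sum_filter, Finset.sum_const, nsmul_eq_mul]
    exact mul_le_mul_of_nonneg_right (by exact_mod_cast hc) (abs_nonneg _)
  rw [← entrySum_transpose]
  calc _ ≤ ∑ l : Fin (n + 1), ∑' k : ℕ, (Set.Ici (l : ℕ)).indicator (fun k => |h k|) k :=
        Finset.sum_le_sum fun l _ => hcol l
    _ = ∑' k : ℕ, ∑ l : Fin (n + 1), (Set.Ici (l : ℕ)).indicator (fun k => |h k|) k :=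
        (Summable.tsum_finsetSum fun (l : Fin (n + 1)) _ => hh.indicator (Set.Ici (l : ℕ))).symm
    _ ≤ _ := Summable.tsum_le_tsum hcount
        (summable_sum fun (l : Fin (n + 1)) _ => hh.indicator (Set.Ici (l : ℕ))) hh'

end Hankel

section CovMatrix

variable (p : Params) {g : ℕ}

theorem toeplitz_isHermitian (n : ℕ) : (toeplitz p.c n).IsHermitian := by
  ext j l
  simp only [toeplitz, Matrix.conjTranspose_apply, Matrix.of_apply, star_trivial]
  rw [← p.c_neg, neg_sub]

theorem covMatrix_row_le (hg : 0 < g) (n : ℕ) (j : Fin (n + 1)) :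
    ∑ l, |covMatrix p g n j l| ≤ ∑' m, |p.c m| + 2 * ∑' k, |p.h k| := by
  have h1 := toeplitz_row_le p.summable_c n j
  have h2 := gHankel_row_le hg p.summable_h n j
  have h3 : ∑ l, |(gHankel g p.h n).transpose j l| ≤ ∑' k, |p.h k| := by
    simp only [Matrix.transpose_apply]
    exact gHankel_col_le p.summable_h n j
  have h4 : ∑ l, |covMatrix p g n j l| ≤ ∑ l, |toeplitz p.c n j l| + ∑ l, |gHankel g p.h n j l|
      + ∑ l, |(gHankel g p.h n).transpose j l| := by
    rw [← Finset.sum_add_distrib, ← Finset.sum_add_distrib]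
    refine Finset.sum_le_sum fun l _ => ?_
    rw [covMatrix, Matrix.add_apply, Matrix.add_apply]
    exact abs_add_three _ _ _
  rw [two_mul, ← add_assoc]
  exact h4.trans (add_le_add (add_le_add h1 h2) h3)

theorem covMatrix_col_le (hg : 0 < g) (n : ℕ) (l : Fin (n + 1)) :
    ∑ j, |covMatrix p g n j l| ≤ ∑' m, |p.c m| + 2 * ∑' k, |p.h k| := by
  refine (Finset.sum_congr rfl fun j _ => ?_).trans_le (covMatrix_row_le p hg n l)
  rw [← (covMatrix_isHermitian p g n).apply, star_trivial]

theorem entrySum_covMatrix_sub_le (hg : 0 < g) (n : ℕ) :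
    entrySum (covMatrix p g n - toeplitz p.c n) ≤ 2 * ∑' k : ℕ, ((k : ℝ) + 1) * |p.h k| := by
  have e : covMatrix p g n - toeplitz p.c n
      = gHankel g p.h n + (gHankel g p.h n).transpose := by
    rw [covMatrix]; abel
  have h1 := entrySum_gHankel_le hg p.summable_h p.summable_mul_h n
  have h2 := entrySum_add_le (gHankel g p.h n) (gHankel g p.h n).transpose
  rw [entrySum_transpose] at h2
  rw [e]
  linarith

/-- The eigenvalues of `C_n` are distributed as the symbol of the Toeplitz part. -/
theorem equidistributedAs_eigenvalues (hg : 0 < g) {q : ℝ → ℝ} (hq : Continuous q)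
    (hsymb : ∀ θ, symbol p.c θ = q θ) :
    EquidistributedAs (fun n => (covMatrix_isHermitian p g n).eigenvalues) q := by
  have hS : 0 ≤ ∑' k, |p.h k| := tsum_nonneg fun _ => abs_nonneg _
  have hT : 0 ≤ ∑' m, |p.c m| := tsum_nonneg fun _ => abs_nonneg _
  refine equidistributedAs_of_moments hq (M := ∑' m, |p.c m| + 2 * ∑' k, |p.h k|)
    (fun n j => abs_eigenvalue_le _ (covMatrix_row_le p hg n) j) (fun θ => ?_) (fun k => ?_)
  · have := norm_symbol_le p.summable_c θ
    rw [hsymb, Complex.norm_real, Real.norm_eq_abs] at this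
    linarith
  · rw [integral_pow_eq_convPow p.summable_c hsymb]
    simp only [← trace_pow]
    exact tendsto_trace_pow p.summable_c p.summable_mul_c (by positivity)
      (covMatrix_col_le p hg) (entrySum_covMatrix_sub_le p hg) k

end CovMatrix

/-! ### The symbol of the model as a sum of theta functions -/

section Theta

/-- Jacobi's functional equation rewrites the theta function on the real axis as a sum of positive
Gaussians. -/
theorem exists_jacobiTheta₂_eq_pos (x : ℝ) {t : ℝ} (ht : 0 < t) :
    ∃ r : ℝ, 0 < r ∧ jacobiTheta₂ x (Complex.I * t) = r := by
  have htC : (t : ℂ) ≠ 0 := by exact_mod_cast ht.ne'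
  have e1 : -Complex.I * (Complex.I * t) = t := by
    rw [← mul_assoc, neg_mul, Complex.I_mul_I, neg_neg, one_mul]
  have e2 : -π * Complex.I * (x : ℂ) ^ 2 / (Complex.I * t) = ((-π * x ^ 2 / t : ℝ) : ℂ) := by
    push_cast
    field_simp
  have e3 : ∀ n : ℤ, jacobiTheta₂_term n (x / (Complex.I * t)) (-1 / (Complex.I * t))
      = ((exp (2 * π * n * x / t - π * n ^ 2 / t) : ℝ) : ℂ) := fun n => by
    rw [jacobiTheta₂_term]
    push_cast
    congr 1
    field_simp
    ring
  have him : 0 < (-1 / (Complex.I * t) : ℂ).im := by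
    have : (-1 / (Complex.I * t) : ℂ) = ((1 / t : ℝ) : ℂ) * Complex.I := by
      push_cast
      field_simp
      rw [Complex.I_sq]
    rw [this, Complex.im_ofReal_mul, Complex.I_im, mul_one]
    positivity
  have hs : Summable fun n : ℤ => exp (2 * π * n * x / t - π * n ^ 2 / t) := by
    have h := (summable_jacobiTheta₂_term_iff (x / (Complex.I * t)) _).2 him
    simp only [e3] at h
    exact Complex.summable_ofReal.1 h
  refine ⟨1 / t ^ (1 / 2 : ℝ) * exp (-π * x ^ 2 / t)
    * ∑' n : ℤ, exp (2 * π * n * x / t - π * n ^ 2 / t), ?_, ?_⟩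
  · have := hs.tsum_pos (fun _ => (exp_pos _).le) 0 (exp_pos _)
    positivity
  · rw [jacobiTheta₂_functional_equation, e1, e2, jacobiTheta₂, tsum_congr e3]
    push_cast
    rw [Complex.ofReal_cpow ht.le]
    push_cast
    rfl

/-- One of the four theta functions that make up the symbol: the sum of the Gaussian sequence
`exp (-(ξ j)² / 4)` against `exp (i j (z + η))`. -/
def gaussianTheta (ξ η : ℝ) (z : ℂ) : ℂ :=
  jacobiTheta₂ ((z + η) / (2 * π)) (Complex.I * ((ξ ^ 2 / (4 * π) : ℝ) : ℂ))

theorem hasSum_gaussianTheta {ξ : ℝ} (hξ : 0 < ξ) (η : ℝ) (z : ℂ) :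
    HasSum (fun j : ℤ => (exp (-(ξ * j) ^ 2 / 4) : ℂ) * Complex.exp (Complex.I * j * (z + η)))
      (gaussianTheta ξ η z) := by
  have him : 0 < (Complex.I * ((ξ ^ 2 / (4 * π) : ℝ) : ℂ)).im := by
    rw [Complex.I_mul_im, Complex.ofReal_re]
    positivity
  have h := hasSum_jacobiTheta₂_term ((z + η) / (2 * π)) him
  have hpi : (π : ℂ) ≠ 0 := by exact_mod_cast pi_ne_zero
  have e : ∀ j : ℤ, jacobiTheta₂_term j ((z + η) / (2 * π))
      (Complex.I * ((ξ ^ 2 / (4 * π) : ℝ) : ℂ))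
      = (exp (-(ξ * j) ^ 2 / 4) : ℂ) * Complex.exp (Complex.I * j * (z + η)) := fun j => by
    have e1 : 2 * π * Complex.I * j * ((z + η) / (2 * π)) = Complex.I * j * (z + η) := by
      field_simp
    have e2 : π * Complex.I * (j : ℂ) ^ 2 * (Complex.I * ((ξ ^ 2 / (4 * π) : ℝ) : ℂ))
        = -(ξ * j) ^ 2 / 4 := by
      push_cast
      field_simp
      rw [Complex.I_sq]
      ring
    rw [jacobiTheta₂_term, e1, e2, Complex.exp_add, mul_comm]
    push_cast
    rfl
  simp only [e] at h
  exact h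

theorem differentiable_gaussianTheta {ξ : ℝ} (hξ : 0 < ξ) (η : ℝ) :
    Differentiable ℂ (gaussianTheta ξ η) := fun z => by
  have him : 0 < (Complex.I * ((ξ ^ 2 / (4 * π) : ℝ) : ℂ)).im := by
    rw [Complex.I_mul_im, Complex.ofReal_re]
    positivity
  have h1 : DifferentiableAt ℂ (fun z : ℂ => (z + η) / (2 * π)) z := by fun_prop
  exact (differentiableAt_jacobiTheta₂_fst _ him).comp z h1

theorem exists_gaussianTheta_eq_pos {ξ : ℝ} (hξ : 0 < ξ) (η θ : ℝ) :
    ∃ r : ℝ, 0 < r ∧ gaussianTheta ξ η θ = r := by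
  have h := exists_jacobiTheta₂_eq_pos ((θ + η) / (2 * π)) (t := ξ ^ 2 / (4 * π)) (by positivity)
  push_cast at h
  simpa [gaussianTheta] using h

end Theta

section ModelSymbol

variable (p : Params)

/-- The extension of the symbol to an entire function. -/
def symbolExt (z : ℂ) : ℂ :=
  p.amp / 2 * ((gaussianTheta p.ξ₁ p.η₁ z + gaussianTheta p.ξ₁ (-p.η₁) z)
    + (gaussianTheta p.ξ₂ p.η₂ z + gaussianTheta p.ξ₂ (-p.η₂) z))

theorem symbol_eq_symbolExt (θ : ℝ) : symbol p.c θ = symbolExt p θ := by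
  have h := (((hasSum_gaussianTheta p.ξ₁_pos p.η₁ θ).add
    (hasSum_gaussianTheta p.ξ₁_pos (-p.η₁) θ)).add
    ((hasSum_gaussianTheta p.ξ₂_pos p.η₂ θ).add
    (hasSum_gaussianTheta p.ξ₂_pos (-p.η₂) θ))).mul_left ((p.amp : ℂ) / 2)
  rw [symbolExt, ← h.tsum_eq, symbol]
  refine tsum_congr fun j => ?_
  have hcos : ∀ η : ℝ, Complex.exp (Complex.I * j * (θ + η))
      + Complex.exp (Complex.I * j * (θ + (-η : ℝ)))
      = 2 * (cos (η * j) : ℂ) * Complex.exp (Complex.I * j * θ) := fun η => by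
    rw [Complex.ofReal_cos, Complex.two_cos, add_mul, ← Complex.exp_add, ← Complex.exp_add]
    congr 2 <;> push_cast <;> ring
  rw [← mul_add, ← mul_add, hcos, hcos, Params.c]
  push_cast
  ring

theorem differentiable_symbolExt : Differentiable ℂ (symbolExt p) :=
  (((differentiable_gaussianTheta p.ξ₁_pos _).add (differentiable_gaussianTheta p.ξ₁_pos _)).add
    ((differentiable_gaussianTheta p.ξ₂_pos _).add
      (differentiable_gaussianTheta p.ξ₂_pos _))).const_mul _

theorem exists_symbol_eq_pos (θ : ℝ) : ∃ r : ℝ, 0 < r ∧ symbol p.c θ = r := by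
  obtain ⟨r₁, h₁, e₁⟩ := exists_gaussianTheta_eq_pos p.ξ₁_pos p.η₁ θ
  obtain ⟨r₂, h₂, e₂⟩ := exists_gaussianTheta_eq_pos p.ξ₁_pos (-p.η₁) θ
  obtain ⟨r₃, h₃, e₃⟩ := exists_gaussianTheta_eq_pos p.ξ₂_pos p.η₂ θ
  obtain ⟨r₄, h₄, e₄⟩ := exists_gaussianTheta_eq_pos p.ξ₂_pos (-p.η₂) θ
  have := p.amp_pos
  refine ⟨p.amp / 2 * ((r₁ + r₂) + (r₃ + r₄)), by positivity, ?_⟩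
  rw [symbol_eq_symbolExt, symbolExt, e₁, e₂, e₃, e₄]
  push_cast
  rfl

/-- The symbol as a real function. -/
def realSymbol (θ : ℝ) : ℝ := (symbol p.c θ).re

theorem symbol_eq_realSymbol (θ : ℝ) : symbol p.c θ = realSymbol p θ := by
  obtain ⟨r, -, e⟩ := exists_symbol_eq_pos p θ
  rw [realSymbol, e, Complex.ofReal_re]

theorem realSymbol_pos (θ : ℝ) : 0 < realSymbol p θ := by
  obtain ⟨r, hr, e⟩ := exists_symbol_eq_pos p θ
  rwa [realSymbol, e, Complex.ofReal_re]

theorem norm_symbol_eq (θ : ℝ) : ‖symbol p.c θ‖ = realSymbol p θ := by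
  rw [symbol_eq_realSymbol, Complex.norm_real, Real.norm_of_nonneg (realSymbol_pos p θ).le]

theorem continuous_realSymbol : Continuous (realSymbol p) :=
  Complex.continuous_re.comp (continuous_symbol p.summable_c)

/-! ### Level sets of the symbol -/

/-- Two points of the unit circle in the same open quadrant or on the same half-axis enclose an
acute angle. -/
theorem cos_sub_pos_of_sign_eq {x y : ℝ} (hc : SignType.sign (cos x) = SignType.sign (cos y))
    (hs : SignType.sign (sin x) = SignType.sign (sin y)) : 0 < cos (x - y) := by
  have hmul : ∀ {u v : ℝ}, SignType.sign u = SignType.sign v → 0 ≤ u * v ∧ (u * v = 0 → u = 0) := by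
    intro u v h
    rcases lt_trichotomy u 0 with hu | hu | hu
    · have hv : v < 0 := by rwa [sign_neg hu, eq_comm, sign_eq_neg_one_iff] at h
      have := mul_pos_of_neg_of_neg hu hv
      exact ⟨this.le, fun h0 => absurd h0 this.ne'⟩
    · exact ⟨by simp [hu], fun _ => hu⟩
    · have hv : 0 < v := by rwa [sign_pos hu, eq_comm, sign_eq_one_iff] at h
      have := mul_pos hu hv
      exact ⟨this.le, fun h0 => absurd h0 this.ne'⟩
  obtain ⟨h1, h2⟩ := hmul hc
  obtain ⟨h3, h4⟩ := hmul hs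
  rw [cos_sub]
  refine lt_of_le_of_ne (add_nonneg h1 h3) fun h0 => ?_
  have hx := sin_sq_add_cos_sq x
  rw [h2 (by linarith), h4 (by linarith)] at hx
  norm_num at hx

/-- Simultaneous recurrence: by the pigeonhole principle there are two times at which the signs of
all four coordinates of two rotations agree, and at their difference both cosines are positive. -/
theorem exists_pos_cos_mul_pos (η₁ η₂ : ℝ) :
    ∃ m : ℤ, 0 < m ∧ 0 < cos (η₁ * m) ∧ 0 < cos (η₂ * m) := by
  obtain ⟨i, j, hij, h⟩ := Finite.exists_ne_map_eq_of_infinite fun k : ℕ =>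
    ((SignType.sign (cos (η₁ * k)), SignType.sign (sin (η₁ * k))),
      (SignType.sign (cos (η₂ * k)), SignType.sign (sin (η₂ * k))))
  simp only [Prod.mk.injEq] at h
  obtain ⟨⟨h1, h2⟩, h3, h4⟩ := h
  wlog hlt : j < i generalizing i j
  · exact this j i hij.symm h1.symm h2.symm h3.symm h4.symm (by omega)
  refine ⟨(i : ℤ) - j, by omega, ?_, ?_⟩
  · have := cos_sub_pos_of_sign_eq h1 h2
    push_cast
    rwa [mul_sub]
  · have := cos_sub_pos_of_sign_eq h3 h4
    push_cast
    rwa [mul_sub]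

theorem exists_c_ne_zero : ∃ m : ℤ, m ≠ 0 ∧ p.c m ≠ 0 := by
  obtain ⟨m, hm, h1, h2⟩ := exists_pos_cos_mul_pos p.η₁ p.η₂
  refine ⟨m, hm.ne', (mul_pos p.amp_pos ?_).ne'⟩
  positivity

/-- The symbol has a nonzero Fourier coefficient other than the mean, hence is not constant. -/
theorem exists_realSymbol_ne (δ : ℝ) : ∃ θ, realSymbol p θ ≠ δ := by
  by_contra! h
  obtain ⟨m, hm, hc⟩ := exists_c_ne_zero p
  have h1 := integral_symbol_mul_exp p.summable_c m
  simp only [symbol_eq_realSymbol, h] at h1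
  rw [integral_const_mul, integral_exp_int, if_neg (neg_ne_zero.2 hm)] at h1
  have hpi : (π : ℂ) ≠ 0 := by exact_mod_cast pi_ne_zero
  simp [hc, hpi] at h1

/-- A nonconstant analytic function has null level sets. -/
theorem volume_realSymbol_eq_zero (δ : ℝ) : volume {θ | realSymbol p θ = δ} = 0 := by
  have han : AnalyticOnNhd ℝ (fun θ : ℝ => symbolExt p θ - δ) Set.univ := fun θ _ => by
    have h1 : AnalyticAt ℝ (symbolExt p) (θ : ℂ) :=
      ((differentiable_symbolExt p).analyticAt _).restrictScalars
    exact (h1.comp (Complex.ofRealCLM.analyticAt θ)).sub analyticAt_const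
  obtain ⟨θ₀, hθ₀⟩ := exists_realSymbol_ne p δ
  have hiff : ∀ θ : ℝ, symbolExt p θ - δ = 0 ↔ realSymbol p θ = δ := fun θ => by
    rw [← symbol_eq_symbolExt, symbol_eq_realSymbol, sub_eq_zero, Complex.ofReal_inj]
  have hcod := han.preimage_zero_mem_codiscrete (x := θ₀) fun h => hθ₀ ((hiff θ₀).1 h)
  have hae := ae_restrict_le_codiscreteWithin (μ := volume) MeasurableSet.univ hcod
  rw [Measure.restrict_univ, mem_ae_iff] at hae
  refine measure_mono_null (fun θ hθ => ?_) hae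
  simpa [hiff] using hθ

end ModelSymbol

/-! ### Distribution of the singular values -/

section SingularValues

variable (p : Params) {g : ℕ}

/-- As the symbol is positive, passing from eigenvalues to their absolute values does not change
the limit distribution. -/
theorem equidistributedAs_singularValues (hg : 0 < g) :
    EquidistributedAs (fun n => σ (covMatrix p g n)) (realSymbol p) := fun F hF => by
  have h := equidistributedAs_eigenvalues p hg (continuous_realSymbol p) (symbol_eq_realSymbol p)
    (fun t => F |t|) (hF.comp continuous_abs)
  simpa only [sum_singularValues_eq (covMatrix_isHermitian p g _), abs_of_pos (realSymbol_pos p _)]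
    using h

theorem svDistributed_covMatrix (hg : 0 < g) : SVDistributed (covMatrix p g) (symbol p.c) := by
  refine ⟨((continuous_symbol p.summable_c).comp continuous_subtype_val).measurable,
    fun F hF _ => ?_⟩
  have hG : Continuous fun t => F |t| := by
    rw [← continuousOn_univ]
    exact hF.comp continuous_abs.continuousOn fun t _ => abs_nonneg t
  have h := equidistributedAs_singularValues p hg _ hG
  simpa only [abs_of_nonneg (singularValue_nonneg _ _), norm_symbol_eq,
    abs_of_pos (realSymbol_pos p _)] using h

end SingularValues

end ToeplitzHankel

end

open ToeplitzHankel in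
theorem mainTheorem3 (p : Params) (g : ℕ) (hg : (g : ℝ) = |p.α₂ / p.α₁|) :
    -- the defining series of the symbol converges absolutely, and its sum is real and bounded
    (Summable fun j : ℤ => |p.c j|) ∧
    (∀ θ : ℝ, (symbol p.c θ).im = 0) ∧
    (BddAbove (Set.range fun θ : Set.Ioo (-π) π => ‖symbol p.c θ‖)) ∧
    -- distribution in the sense of singular values
    SVDistributed (covMatrix p g) (symbol p.c) ∧
    -- uniform bound on the singular values
    (Summable fun j : ℕ => |p.h j|) ∧
    (∃ bT : ℝ, (∀ (n : ℕ) (j : Fin (n + 1)), σ (toeplitz p.c n) j ≤ bT) ∧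
      ∀ (n : ℕ) (j : Fin (n + 1)), σ (covMatrix p g n) j ≤ bT + 2 * ∑' k : ℕ, |p.h k|) ∧
    -- extension to the threshold function, and the normalized essential rank
    ∀ ε : ℝ, 0 < ε →
      Tendsto (fun n : ℕ => 1 / ((n : ℝ) + 1) *
          ∑ j, (Set.Ici (ε * supNorm (symbol p.c))).indicator (fun _ => (1 : ℝ))
            (σ (covMatrix p g n) j)) atTop
        (𝓝 (1 / (2 * π) * ∫ θ in Set.Ioo (-π) π,
          (Set.Ici (ε * supNorm (symbol p.c))).indicator (fun _ => (1 : ℝ)) ‖symbol p.c θ‖)) ∧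
      Tendsto (fun n : ℕ =>
          (singularValueCount (covMatrix p g n) (ε * supNorm (symbol p.c)) : ℝ) / ((n : ℝ) + 1))
        atTop (𝓝 (1 / (2 * π) * volume.real
          {θ : ℝ | θ ∈ Set.Ioo (-π) π ∧ ε * supNorm (symbol p.c) ≤ (symbol p.c θ).re})) ∧
      Tendsto (fun n : ℕ =>
          (eigenvalueCount (covMatrix_isHermitian p g n) (ε * supNorm (symbol p.c)) : ℝ)
            / ((n : ℝ) + 1))
        atTop (𝓝 (1 / (2 * π) * volume.real
          {θ : ℝ | θ ∈ Set.Ioo (-π) π ∧ ε * supNorm (symbol p.c) ≤ (symbol p.c θ).re})) := by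
  have hg0 : 0 < g := by
    have h : (0 : ℝ) < g := hg ▸ abs_pos.2 p.ratio_neg.ne
    exact_mod_cast h
  have hq := continuous_realSymbol p
  refine ⟨p.summable_c, fun θ => by rw [symbol_eq_realSymbol, Complex.ofReal_im],
    ⟨∑' m, |p.c m|, ?_⟩, svDistributed_covMatrix p hg0, p.summable_h,
    ⟨∑' m, |p.c m|, fun n j => ?_, fun n j => ?_⟩, fun ε _ => ⟨?_, ?_, ?_⟩⟩
  · rintro _ ⟨θ, rfl⟩
    exact norm_symbol_le p.summable_c θ
  · exact singularValue_le (toeplitz_isHermitian p n) (toeplitz_row_le p.summable_c n) j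
  · exact singularValue_le (covMatrix_isHermitian p g n) (covMatrix_row_le p hg0 n) j
  · simp only [norm_symbol_eq]
    exact (equidistributedAs_singularValues p hg0).tendsto_indicator hq
      (volume_realSymbol_eq_zero p _)
  · exact (equidistributedAs_singularValues p hg0).tendsto_card hq (volume_realSymbol_eq_zero p _)
  · exact (equidistributedAs_eigenvalues p hg0 hq (symbol_eq_realSymbol p)).tendsto_card hq
      (volume_realSymbol_eq_zero p _)
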